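/- **Theorem 2.1.** Let $p>3$ be a prime, let $a\in\mathbb Z_p$ be a $p$-adic integer (in particular, $a$ may be any rational number whose denominator is not divisible by $p$) with $a\not\equiv 0\pmod p$, and let $\langle a\rangle_p\in\{0,1,\ldots,p-1\}$ be the residue with $a\equiv\langle a\rangle_p\pmod p$. Let $B_n$ be the Bernoulli numbers (with $B_1=-\tfrac12$), $B_n(x)=\sum_{k=0}^n\binom nk B_kx^{n-k}$ the Bernoulli polynomials, and $\binom xk=\frac{x(x-1)\cdots(x-k+1)}{k!}$. For $x,y\in\mathbb Q_p$, $x\equiv y\pmod{p^2}$ means $x-y\in p^2\mathbb Z_p$. Then $$\sum_{k=1}^{(p-1)/2}\frac{\binom ak\binom{-1-a}k}{k}+2\sum_{k=1}^{p-1}\frac{(-1)^{k-1}}{k}\binom ak\equiv\begin{cases}0\pmod{p^2}&\text{if }\langle a\rangle_p\le\frac{p-1}2,\\ pB_{p-2}(-a)\pmod{p^2}&\text{if }\langle a\rangle_p>\frac{p-1}2,\end{cases}$$ and $$\sum_{k=1}^{p-1}\frac{(-1)^{k-1}}{k}\binom ak\equiv-\frac{B_{2p-2}(-a)-B_{2p-2}}{2p-2}+2\,\frac{B_{p-1}(-a)-B_{p-1}}{p-1}-\frac{a-\langle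 a\rangle_p}2B_{p-2}(-a)\pmod{p^2}.$$ -/

import Mathlib

/-- The congruence `x ≡ y (mod p ^ n)` for `p`-adic numbers `x` and `y`: the difference
`x - y` is `p ^ n` times a `p`-adic integer. -/
def PadicCongr (p : ℕ) [Fact p.Prime] (n : ℕ) (x y : ℚ_[p]) : Prop :=
  ∃ z : ℤ_[p], x - y = (p : ℚ_[p]) ^ n * (z : ℚ_[p])

/-- The binomial coefficient `a (a - 1) ⋯ (a - k + 1) / k!` of a `p`-adic integer `a`,
regarded as a `p`-adic number. -/
noncomputable def padicChoose (p : ℕ) [Fact p.Prime] (a : ℤ_[p]) (k : ℕ) : ℚ_[p] :=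
  ((Ring.choose a k : ℤ_[p]) : ℚ_[p])

/-- The value `B_n(x)` of the `n`-th Bernoulli polynomial at a `p`-adic number `x`. -/
noncomputable def bernoulliValue (p : ℕ) [Fact p.Prime] (n : ℕ) (x : ℚ_[p]) : ℚ_[p] :=
  Polynomial.aeval x (Polynomial.bernoulli n)

open Finset

/-! ### Calculus of congruences modulo powers of p in ℚ_p -/

namespace PadicCongr

variable {p : ℕ} [Fact p.Prime] {n : ℕ} {x y z w : ℚ_[p]}

/-! Let r be the residue of a, t = a - r, p = 2m + 1. Both sides are compared along x = t + j for j
= 0, …, r, where every x + 1 that occurs is a unit. It suffices to match starting values and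
increments modulo p². Write S and T for the alternating sum and the product sum. Exact difference
equations (`altChooseSum_add_one_sub`, `chooseMulSum_add_one_sub`) and Wilson's theorem give, modulo
p², the increments of S as 1/(x+1) - t/(x+1)², and those of T + 2S as 0 for j < m and 2p/(x+1)² for
j ≥ m. On the Bernoulli side, B_n(1+y) - B_n(y) = n y^(n-1) and Fermat show that B_{p-2}(-x) has
increment 2/(x+1)² modulo p, while the combination of B_{2p-2} and B_{p-1} has increment 1/(x+1)
modulo p². At j = 0 everything vanishes modulo p², because sums of inverse squares up to m and up to
p - 1 vanish modulo p. The second case starts at j = m, where B_{p-2}(-x) vanishes modulo p by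
reflection. -/

theorem iff_norm_sub_le : PadicCongr p n x y ↔ ‖x - y‖ ≤ (p : ℝ) ^ (-n : ℤ) := by
  have hp0 : (p : ℚ_[p]) ≠ 0 := by exact_mod_cast (Fact.out : p.Prime).ne_zero
  have hp : (0 : ℝ) < (p : ℝ) ^ n := pow_pos (by exact_mod_cast (Fact.out : p.Prime).pos) n
  rw [zpow_neg, zpow_natCast, ← one_div, le_div_iff₀ hp]
  constructor
  · rintro ⟨z, hz⟩
    rw [hz, norm_mul, norm_pow, Padic.norm_p, inv_pow, mul_comm, mul_inv_cancel_left₀ hp.ne']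
    exact z.2
  · intro h
    refine ⟨⟨(x - y) / (p : ℚ_[p]) ^ n, ?_⟩, ?_⟩
    · rwa [norm_div, norm_pow, Padic.norm_p, inv_pow, div_inv_eq_mul]
    · rw [mul_div_cancel₀ _ (pow_ne_zero _ hp0)]

theorem refl (x : ℚ_[p]) : PadicCongr p n x x := ⟨0, by simp⟩

theorem of_eq (h : x = y) : PadicCongr p n x y := h ▸ refl x

theorem symm (h : PadicCongr p n x y) : PadicCongr p n y x := by
  obtain ⟨a, ha⟩ := h
  exact ⟨-a, by push_cast; linear_combination -ha⟩

theorem trans (h : PadicCongr p n x y) (h' : PadicCongr p n y z) : PadicCongr p n x z := by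
  obtain ⟨a, ha⟩ := h
  obtain ⟨b, hb⟩ := h'
  exact ⟨a + b, by push_cast; linear_combination ha + hb⟩

theorem add (h : PadicCongr p n x y) (h' : PadicCongr p n z w) :
    PadicCongr p n (x + z) (y + w) := by
  obtain ⟨a, ha⟩ := h
  obtain ⟨b, hb⟩ := h'
  exact ⟨a + b, by push_cast; linear_combination ha + hb⟩

theorem neg (h : PadicCongr p n x y) : PadicCongr p n (-x) (-y) := by
  obtain ⟨a, ha⟩ := h
  exact ⟨-a, by push_cast; linear_combination -ha⟩

theorem sub (h : PadicCongr p n x y) (h' : PadicCongr p n z w) :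
    PadicCongr p n (x - z) (y - w) := by
  simpa [sub_eq_add_neg] using h.add h'.neg

theorem sum {ι : Type*} {s : Finset ι} {f g : ι → ℚ_[p]}
    (h : ∀ i ∈ s, PadicCongr p n (f i) (g i)) : PadicCongr p n (∑ i ∈ s, f i) (∑ i ∈ s, g i) := by
  classical
  induction s using Finset.induction_on with
  | empty => simpa using refl 0
  | insert i s hi ih =>
    rw [sum_insert hi, sum_insert hi]
    exact (h i (mem_insert_self i s)).add (ih fun j hj => h j (mem_insert_of_mem hj))

theorem mul_left (hz : ‖z‖ ≤ 1) (h : PadicCongr p n x y) : PadicCongr p n (z * x) (z * y) := by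
  obtain ⟨a, ha⟩ := h
  obtain ⟨b, rfl⟩ : ∃ b : ℤ_[p], (b : ℚ_[p]) = z := ⟨⟨z, hz⟩, rfl⟩
  exact ⟨b * a, by push_cast; linear_combination (b : ℚ_[p]) * ha⟩

theorem mul_right (hz : ‖z‖ ≤ 1) (h : PadicCongr p n x y) : PadicCongr p n (x * z) (y * z) := by
  simpa only [mul_comm _ z] using h.mul_left hz

theorem mul (hx : ‖x‖ ≤ 1) (hw : ‖w‖ ≤ 1) (h : PadicCongr p n x y) (h' : PadicCongr p n z w) :
    PadicCongr p n (x * z) (y * w) :=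
  (h'.mul_left hx).trans (h.mul_right hw)

theorem of_mul_left (hz : ‖z‖ = 1) (h : PadicCongr p n (z * x) (z * y)) : PadicCongr p n x y := by
  have hz0 : z ≠ 0 := norm_ne_zero_iff.mp (by rw [hz]; exact one_ne_zero)
  simpa [hz0] using h.mul_left (z := z⁻¹) (by simp [hz])

theorem mul_of_padicCongr_zero {m : ℕ} (hz : PadicCongr p m z 0) (h : PadicCongr p n x y) :
    PadicCongr p (m + n) (z * x) (z * y) := by
  obtain ⟨a, ha⟩ := hz
  obtain ⟨b, hb⟩ := h
  exact ⟨a * b, by push_cast; rw [pow_add]; linear_combination z * hb + p ^ n * b * ha⟩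

/-- The source of the modulus p² throughout: beside a factor divisible by p, the cofactor matters
only modulo p. -/
theorem mul_congr_sq (hz : PadicCongr p 1 z 0) (h : PadicCongr p 1 x y) :
    PadicCongr p 2 (z * x) (z * y) := mul_of_padicCongr_zero hz h

theorem natCast_self : PadicCongr p 1 (p : ℚ_[p]) 0 := ⟨1, by simp⟩

theorem coe_iff {a b : ℤ_[p]} : PadicCongr p n (a : ℚ_[p]) b ↔ (p : ℤ_[p]) ^ n ∣ a - b := by
  constructor
  · rintro ⟨c, hc⟩
    exact ⟨c, PadicInt.ext (by push_cast; exact hc)⟩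
  · rintro ⟨c, hc⟩
    exact ⟨c, by rw [← PadicInt.coe_sub, hc]; push_cast; rfl⟩

theorem coe_iff_toZMod_eq {a b : ℤ_[p]} :
    PadicCongr p 1 (a : ℚ_[p]) b ↔ PadicInt.toZMod a = PadicInt.toZMod b := by
  rw [coe_iff, pow_one, ← sub_eq_zero (a := PadicInt.toZMod a), ← map_sub, ← RingHom.mem_ker,
    PadicInt.ker_toZMod, PadicInt.maximalIdeal_eq_span_p, Ideal.mem_span_singleton]

theorem norm_le_one (h : PadicCongr p n x y) (hy : ‖y‖ ≤ 1) : ‖x‖ ≤ 1 := by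
  obtain ⟨a, ha⟩ := h
  obtain ⟨b, rfl⟩ : ∃ b : ℤ_[p], (b : ℚ_[p]) = y := ⟨⟨y, hy⟩, rfl⟩
  have : x = (((p : ℤ_[p]) ^ n * a + b : ℤ_[p]) : ℚ_[p]) := by
    push_cast; linear_combination ha
  rw [this]
  exact PadicInt.norm_le_one _

theorem norm_eq_one (h : PadicCongr p 1 x y) (hy : ‖y‖ = 1) : ‖x‖ = 1 := by
  have h1 := iff_norm_sub_le.mp h
  have h2 : ‖x - y‖ < ‖y‖ := by
    rw [hy]
    refine h1.trans_lt ?_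
    have : (1 : ℝ) < p := by exact_mod_cast (Fact.out : p.Prime).one_lt
    simpa using inv_lt_one_of_one_lt₀ this
  have := Padic.add_eq_max_of_ne h2.ne
  rw [sub_add_cancel, max_eq_right h2.le] at this
  rw [this, hy]

theorem pow_card_sub_one (hx : ‖x‖ = 1) : PadicCongr p 1 (x ^ (p - 1)) 1 := by
  obtain ⟨x, rfl⟩ : ∃ b : ℤ_[p], (b : ℚ_[p]) = x := ⟨⟨x, hx.le⟩, rfl⟩
  rw [← PadicInt.coe_pow, ← PadicInt.coe_one, coe_iff_toZMod_eq, map_pow, map_one]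
  refine ZMod.pow_card_sub_one_eq_one fun h => ?_
  rw [← map_zero PadicInt.toZMod, ← coe_iff_toZMod_eq] at h
  have := iff_norm_sub_le.mp h
  rw [PadicInt.coe_zero, sub_zero, hx] at this
  have hp : (1 : ℝ) < p := by exact_mod_cast (Fact.out : p.Prime).one_lt
  have := inv_lt_one_of_one_lt₀ hp
  simp at *
  linarith

theorem of_step {F G : ℕ → ℚ_[p]} {r s : ℕ} (hrs : r ≤ s) (h0 : PadicCongr p n (F r) (G r))
    (h : ∀ j, r ≤ j → j < s → PadicCongr p n (F (j + 1) - F j) (G (j + 1) - G j)) :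
    PadicCongr p n (F s) (G s) := by
  induction s, hrs using Nat.le_induction with
  | base => exact h0
  | succ s hs ih =>
    simpa using (ih fun j h1 h2 => h j h1 (by omega)).add (h s hs (by omega))

end PadicCongr

section

variable {p : ℕ} [Fact p.Prime]

theorem norm_natCast_eq_one_of_lt {k : ℕ} (h0 : 0 < k) (hk : k < p) : ‖(k : ℚ_[p])‖ = 1 := by
  rw [Padic.norm_natCast_eq_one_iff]
  exact Nat.coprime_of_lt_prime h0.ne' hk Fact.out

theorem norm_factorial_eq_one {k : ℕ} (hk : k < p) : ‖(k.factorial : ℚ_[p])‖ = 1 := by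
  rw [Padic.norm_natCast_eq_one_iff]
  exact Nat.Prime.coprime_factorial_of_lt Fact.out hk

end

theorem PadicInt.coe_finset_prod {p : ℕ} [Fact p.Prime] {ι : Type*} (s : Finset ι)
    (f : ι → ℤ_[p]) : ((∏ i ∈ s, f i : ℤ_[p]) : ℚ_[p]) = ∏ i ∈ s, (f i : ℚ_[p]) := by
  classical
  induction s using Finset.induction_on with
  | empty => simp
  | insert i s hi ih => rw [prod_insert hi, prod_insert hi, PadicInt.coe_mul, ih]

/-! ### Binomial coefficients and difference equations for the two sums -/

section Choose

variable (p : ℕ) [Fact p.Prime]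

theorem factorial_mul_padicChoose (a : ℤ_[p]) (k : ℕ) :
    (k.factorial : ℚ_[p]) * padicChoose p a k = ∏ i ∈ range k, ((a : ℚ_[p]) - i) := by
  have h := Ring.descPochhammer_eq_factorial_smul_choose a k
  rw [nsmul_eq_mul, ← Polynomial.aeval_eq_smeval, Polynomial.aeval_def,
    Polynomial.eval₂_eq_eval_map, descPochhammer_map, descPochhammer_eval_eq_prod_range] at h
  have h' := congrArg (fun t : ℤ_[p] => (t : ℚ_[p])) h
  simp only [PadicInt.coe_finset_prod] at h'
  simpa [padicChoose] using h'.symm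

theorem padicChoose_zero (a : ℤ_[p]) : padicChoose p a 0 = 1 := by
  simp [padicChoose]

theorem succ_mul_padicChoose_succ (a : ℤ_[p]) (k : ℕ) :
    ((k : ℚ_[p]) + 1) * padicChoose p a (k + 1) = ((a : ℚ_[p]) - k) * padicChoose p a k := by
  have h := factorial_mul_padicChoose p a (k + 1)
  rw [prod_range_succ, ← factorial_mul_padicChoose, Nat.factorial_succ] at h
  have hk : (k.factorial : ℚ_[p]) ≠ 0 := by exact_mod_cast k.factorial_ne_zero
  push_cast at h
  exact mul_left_cancel₀ hk (by linear_combination h)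

theorem succ_mul_padicChoose_add_one_succ (a : ℤ_[p]) (k : ℕ) :
    ((k : ℚ_[p]) + 1) * padicChoose p (a + 1) (k + 1) = ((a : ℚ_[p]) + 1) * padicChoose p a k := by
  have h := factorial_mul_padicChoose p (a + 1) (k + 1)
  rw [prod_range_succ', Nat.factorial_succ] at h
  have h' := factorial_mul_padicChoose p a k
  have hk : (k.factorial : ℚ_[p]) ≠ 0 := by exact_mod_cast k.factorial_ne_zero
  push_cast at h
  simp only [add_sub_add_right_eq_sub, sub_zero] at h
  exact mul_left_cancel₀ hk (by linear_combination h - (a + 1 : ℚ_[p]) * h')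

theorem padicChoose_succ_succ (a : ℤ_[p]) (k : ℕ) :
    padicChoose p (a + 1) (k + 1) = padicChoose p a k + padicChoose p a (k + 1) := by
  simp [padicChoose, Ring.choose_succ_succ]

theorem norm_padicChoose_le_one (a : ℤ_[p]) (k : ℕ) : ‖padicChoose p a k‖ ≤ 1 :=
  PadicInt.norm_le_one _

/-- The alternating sum `∑ (-1) ^ (k - 1) * binom a k / k` over `1 ≤ k ≤ N`. -/
noncomputable def altChooseSum (a : ℤ_[p]) (N : ℕ) : ℚ_[p] :=
  ∑ k ∈ Icc 1 N, (-1 : ℚ_[p]) ^ (k - 1) / (k : ℚ_[p]) * padicChoose p a k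

/-- The sum `∑ binom a k * binom (-1 - a) k / k` over `1 ≤ k ≤ N`. -/
noncomputable def chooseMulSum (a : ℤ_[p]) (N : ℕ) : ℚ_[p] :=
  ∑ k ∈ Icc 1 N, padicChoose p a k * padicChoose p (-1 - a) k / (k : ℚ_[p])

/-- By Pascal and absorption, (a+1)/k times binom(a+1, k) - binom(a, k) is binom(a+1, k), and the
alternating sum of these telescopes by Pascal again. -/
theorem altChooseSum_add_one_sub (a : ℤ_[p]) (N : ℕ) :
    ((a : ℚ_[p]) + 1) * (altChooseSum p (a + 1) N - altChooseSum p a N) =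
      1 - (-1) ^ N * padicChoose p a N := by
  induction N with
  | zero => simp [altChooseSum, padicChoose_zero]
  | succ N ih =>
    have hN : (N : ℚ_[p]) + 1 ≠ 0 := by exact_mod_cast N.succ_ne_zero
    have e : ∀ b : ℤ_[p], altChooseSum p b (N + 1) =
        altChooseSum p b N + (-1 : ℚ_[p]) ^ N / ((N : ℚ_[p]) + 1) * padicChoose p b (N + 1) := by
      intro b
      simp [altChooseSum, sum_Icc_succ_top]
    have h1 := succ_mul_padicChoose_add_one_succ p a N
    have h2 := padicChoose_succ_succ p a N
    rw [e, e]
    have h3 : padicChoose p a N = padicChoose p (a + 1) (N + 1) - padicChoose p a (N + 1) := by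
      rw [h2]; ring
    have h4 : ((a : ℚ_[p]) + 1) / ((N : ℚ_[p]) + 1) * padicChoose p a N
        = padicChoose p (a + 1) (N + 1) := by
      field_simp
      linear_combination -h1
    linear_combination ih - (-1) ^ N * ((a + 1 : ℚ_[p]) / ((N : ℚ_[p]) + 1)) * h3
      + (-1) ^ N * h4 + (-1) ^ N * h2

theorem chooseMulSum_add_one_sub (a : ℤ_[p]) (N : ℕ) :
    ((a : ℚ_[p]) + 1) * (chooseMulSum p (a + 1) N - chooseMulSum p a N) =
      2 * (padicChoose p a N * padicChoose p (-2 - a) N - 1) := by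
  induction N with
  | zero => simp [chooseMulSum, padicChoose_zero]
  | succ N ih =>
    have hN : (N : ℚ_[p]) + 1 ≠ 0 := by exact_mod_cast N.succ_ne_zero
    have e : ∀ b : ℤ_[p], chooseMulSum p b (N + 1) = chooseMulSum p b N +
        padicChoose p b (N + 1) * padicChoose p (-1 - b) (N + 1) / ((N : ℚ_[p]) + 1) := by
      intro b
      simp [chooseMulSum, sum_Icc_succ_top]
    rw [e, e, show -1 - (a + 1) = -2 - a by ring]
    have h1 := succ_mul_padicChoose_add_one_succ p a N
    have h2 := succ_mul_padicChoose_succ p a N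
    have h3 := succ_mul_padicChoose_succ p (-2 - a) N
    have h4 := succ_mul_padicChoose_add_one_succ p (-2 - a) N
    rw [show -2 - a + 1 = -1 - a by ring] at h4
    have h5 : ((2 : ℤ_[p]) : ℚ_[p]) = 2 := rfl
    push_cast at h3 h4
    rw [h5] at h3 h4
    -- All four coefficients of index N + 1 become rational multiples of binom(a, N) or binom(-2-a,
    -- N), leaving a rational identity.
    rw [mul_comm, ← eq_div_iff hN] at h1 h2 h3 h4
    rw [h1, h2, h3, h4]
    rw [add_sub_add_comm, mul_add, ih]
    field_simp
    ring

end Choose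

/-! ### Wilson-type products over complete residue systems -/

section Product

variable {p : ℕ} [Fact p.Prime]

/-- The involution i ↦ j - i carries the residues other than j to the nonzero ones, so this is
Wilson's theorem. -/
theorem ZMod.prod_erase_natCast_sub {j : ℕ} (hj : j < p) :
    ∏ i ∈ (range p).erase j, ((j : ZMod p) - i) = -1 := by
  rw [← ZMod.prod_Ico_one_prime p]
  refine prod_nbij' (fun i => ((j : ZMod p) - i).val) (fun i => ((j : ZMod p) - i).val)
    ?_ ?_ ?_ ?_ ?_
  · intro i hi
    rw [mem_erase, mem_range] at hi
    rw [mem_Ico, Nat.one_le_iff_ne_zero, Ne, ZMod.val_eq_zero, sub_eq_zero]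
    refine ⟨fun h => hi.1 ?_, ZMod.val_lt _⟩
    have := congrArg ZMod.val h
    rwa [ZMod.val_cast_of_lt hj, ZMod.val_cast_of_lt hi.2, eq_comm] at this
  · intro i hi
    rw [mem_Ico] at hi
    rw [mem_erase, mem_range]
    refine ⟨fun h => ?_, ZMod.val_lt _⟩
    have := congrArg (Nat.cast : ℕ → ZMod p) h
    rw [ZMod.natCast_zmod_val, sub_eq_self] at this
    have := congrArg ZMod.val this
    rw [ZMod.val_cast_of_lt hi.2, ZMod.val_zero] at this
    omega
  · intro i hi
    rw [mem_erase, mem_range] at hi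
    simp [ZMod.val_cast_of_lt hi.2]
  · intro i hi
    rw [mem_Ico] at hi
    simp [ZMod.val_cast_of_lt hi.2]
  · intro i hi
    simp

/-- The factor at j is divisible by p, so the others are needed only modulo p. The representatives c
stay free because their choice shows modulo p². -/
theorem padicCongr_prod_sub {j : ℕ} (hj : j < p) {x : ℤ_[p]} {c : ℕ → ℤ_[p]}
    (hc : ∀ i < p, PadicInt.toZMod (c i) = (i : ZMod p)) (hx : PadicInt.toZMod x = (j : ZMod p)) :
    PadicCongr p 2 (∏ i ∈ range p, ((x : ℚ_[p]) - c i)) (-((x : ℚ_[p]) - c j)) := by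
  rw [← mul_prod_erase _ _ (mem_range.mpr hj), ← mul_neg_one]
  refine PadicCongr.mul_congr_sq ?_ ?_
  · rw [← PadicInt.coe_sub, ← PadicInt.coe_zero, PadicCongr.coe_iff_toZMod_eq]
    simp [hx, hc j hj]
  · have : ∏ i ∈ (range p).erase j, ((x : ℚ_[p]) - c i) =
        ((∏ i ∈ (range p).erase j, (x - c i) : ℤ_[p]) : ℚ_[p]) := by
      simp [PadicInt.coe_finset_prod]
    rw [this, ← PadicInt.coe_one, ← PadicInt.coe_neg, PadicCongr.coe_iff_toZMod_eq, map_prod,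
      map_neg, map_one, ← ZMod.prod_erase_natCast_sub hj]
    refine prod_congr rfl fun i hi => ?_
    rw [mem_erase, mem_range] at hi
    rw [map_sub, hx, hc i hi.2]

theorem padicCongr_factorial_pred : PadicCongr p 1 ((p - 1).factorial : ℚ_[p]) (-1) := by
  have := ZMod.wilsons_lemma p
  rw [← PadicInt.coe_natCast, ← PadicInt.coe_one, ← PadicInt.coe_neg, PadicCongr.coe_iff_toZMod_eq]
  simp [this]

theorem ZMod.factorial_half_sq {m : ℕ} (hm : p = 2 * m + 1) :
    (-1) ^ m * (m.factorial : ZMod p) ^ 2 = -1 := by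
  have h := ZMod.wilsons_lemma p
  rw [show p - 1 = 2 * m by omega, ← prod_range_add_one_eq_factorial, two_mul, prod_range_add,
    ← prod_range_reflect (fun i => m + i + 1), prod_range_add_one_eq_factorial] at h
  have e : ∀ i ∈ range m, ((m + (m - 1 - i) + 1 : ℕ) : ZMod p) = (-1) * ((i + 1 : ℕ) : ZMod p) := by
    intro i hi
    rw [mem_range] at hi
    have : (m + (m - 1 - i) + 1) + (i + 1) = p := by omega
    have := congrArg (Nat.cast : ℕ → ZMod p) this
    rw [Nat.cast_add, ZMod.natCast_self] at this
    linear_combination this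
  rw [Nat.cast_mul, Nat.cast_prod, prod_congr rfl e, prod_mul_distrib, ← Nat.cast_prod,
    prod_range_add_one_eq_factorial] at h
  simp at h
  linear_combination h

theorem padicCongr_factorial_half_sq {m : ℕ} (hm : p = 2 * m + 1) :
    PadicCongr p 1 ((-1) ^ m * (m.factorial : ℚ_[p]) ^ 2) (-1) := by
  have := ZMod.factorial_half_sq hm
  have e : (-1) ^ m * (m.factorial : ℚ_[p]) ^ 2 =
      (((-1) ^ m * (m.factorial : ℤ_[p]) ^ 2 : ℤ_[p]) : ℚ_[p]) := by push_cast; rfl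
  rw [e, ← PadicInt.coe_one, ← PadicInt.coe_neg, PadicCongr.coe_iff_toZMod_eq]
  simpa using this

theorem padicCongr_add_one_mul_padicChoose {j : ℕ} (hj : j + 1 < p) {x : ℤ_[p]}
    (hx : PadicInt.toZMod x = (j : ZMod p)) :
    PadicCongr p 2 (((x : ℚ_[p]) + 1) * padicChoose p x (p - 1)) ((x : ℚ_[p]) - j) := by
  have hx0 : PadicCongr p 1 ((x : ℚ_[p]) - j) 0 := by
    rw [← PadicInt.coe_natCast, ← PadicInt.coe_sub, ← PadicInt.coe_zero,
      PadicCongr.coe_iff_toZMod_eq]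
    simp [hx]
  refine PadicCongr.of_mul_left (z := ((p - 1).factorial : ℚ_[p]))
    (norm_factorial_eq_one (by omega)) ?_
  -- The system 0, …, p-2, -1 yields (p-1)! binom(x, p-1) (x+1).
  have h := padicCongr_prod_sub (j := j) (by omega) (x := x)
    (c := fun i => if i < p - 1 then (i : ℤ_[p]) else -1) ?_ hx
  · obtain ⟨q, rfl⟩ : ∃ q, p = q + 1 := ⟨p - 1, by omega⟩
    rw [prod_range_succ, prod_congr rfl (g := fun i : ℕ => (x : ℚ_[q + 1]) - i)] at h
    · rw [Nat.add_sub_cancel] at h ⊢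
      rw [← factorial_mul_padicChoose, if_neg (by omega), if_pos (by omega)] at h
      refine PadicCongr.trans (PadicCongr.of_eq ?_) (h.trans ?_)
      · push_cast; ring
      · have := PadicCongr.mul_congr_sq hx0 padicCongr_factorial_pred.symm
        rw [Nat.add_sub_cancel] at this
        convert this using 1
        · push_cast; ring
        · ring
    · intro i hi
      rw [mem_range] at hi
      simp [hi]
  · intro i hi
    split_ifs with h
    · simp
    · rw [show i = p - 1 by omega, Nat.cast_sub (by omega)]
      simp

theorem padicCongr_add_one_mul_padicChoose_mul {m j : ℕ} (hm : p = 2 * m + 1) (hj : j + 1 < p)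
    {x : ℤ_[p]} (hx : PadicInt.toZMod x = (j : ZMod p)) :
    PadicCongr p 2 (((x : ℚ_[p]) + 1) * (padicChoose p x m * padicChoose p (-2 - x) m))
      ((x : ℚ_[p]) - j + if j < m then 0 else (p : ℚ_[p])) := by
  have hx0 : PadicCongr p 1 ((x : ℚ_[p]) - j + if j < m then 0 else (p : ℚ_[p])) 0 := by
    have h1 : PadicCongr p 1 ((x : ℚ_[p]) - j) 0 := by
      rw [← PadicInt.coe_natCast, ← PadicInt.coe_sub, ← PadicInt.coe_zero,
        PadicCongr.coe_iff_toZMod_eq]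
      simp [hx]
    split_ifs
    · simpa using h1
    · simpa using h1.add PadicCongr.natCast_self
  refine PadicCongr.of_mul_left (z := (-1) ^ m * (m.factorial : ℚ_[p]) ^ 2)
    (by simp [norm_factorial_eq_one (p := p) (k := m) (by omega)]) ?_
  -- The system -(m+1), …, m-1: the negative members give x + 1 and, up to sign, m! binom(-2-x, m).
  -- For j ≥ m the representative is j - p, whence the extra p.
  have h := padicCongr_prod_sub (j := j) (by omega) (x := x)
    (c := fun i => if i < m then (i : ℤ_[p]) else (i : ℤ_[p]) - p) ?_ hx
  · have e : ∏ i ∈ range p, ((x : ℚ_[p]) -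
        ((if i < m then (i : ℤ_[p]) else (i : ℤ_[p]) - p : ℤ_[p]) : ℚ_[p])) =
        (-1) ^ m * (m.factorial : ℚ_[p]) ^ 2 *
          (((x : ℚ_[p]) + 1) * (padicChoose p x m * padicChoose p (-2 - x) m)) := by
      have hA := factorial_mul_padicChoose p x m
      have hB := factorial_mul_padicChoose p (-2 - x) m
      rw [← prod_range_reflect] at hB
      rw [congrArg range hm, prod_range_succ, two_mul, prod_range_add]
      rw [prod_congr rfl (g := fun i : ℕ => (x : ℚ_[p]) - i), ← hA,
        prod_congr rfl (s₁ := range m) (g := fun i : ℕ => (-1) *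
          (((-2 - x : ℤ_[p]) : ℚ_[p]) - (m - 1 - i : ℕ))), prod_mul_distrib, ← hB]
      · have : (p : ℚ_[p]) = 2 * m + 1 := by exact_mod_cast congrArg (Nat.cast : ℕ → ℚ_[p]) hm
        rw [if_neg (by omega), prod_const, card_range]
        push_cast
        rw [this]
        ring
      · intro i hi
        rw [mem_range] at hi
        have h1 : (m - 1 - i) + (m + i) + 2 = p := by omega
        have h2 := congrArg (Nat.cast : ℕ → ℚ_[p]) h1
        push_cast at h2
        have h5 : ((2 : ℤ_[p]) : ℚ_[p]) = 2 := rfl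
        rw [if_neg (by omega)]
        push_cast
        rw [h5]
        linear_combination -h2
      · intro i hi
        rw [mem_range] at hi
        simp [hi]
    rw [e] at h
    refine h.trans ?_
    have := PadicCongr.mul_congr_sq hx0 (padicCongr_factorial_half_sq hm).symm
    convert this using 1
    · split_ifs <;> push_cast <;> ring
    · ring
  · intro i hi
    split_ifs with h <;> simp

end Product

theorem PadicCongr.pow {p : ℕ} [Fact p.Prime] {n : ℕ} {x y : ℚ_[p]} (hx : ‖x‖ ≤ 1)
    (h : PadicCongr p n x y) (k : ℕ) : PadicCongr p n (x ^ k) (y ^ k) := by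
  have hy : ‖y‖ ≤ 1 := h.symm.norm_le_one hx
  induction k with
  | zero => simpa using PadicCongr.refl 1
  | succ k ih =>
    rw [pow_succ, pow_succ]
    exact PadicCongr.mul (by rw [norm_pow]; exact pow_le_one₀ (norm_nonneg _) hx) hy ih h

/-! ### Integrality and congruences of Bernoulli values; sums of inverse squares -/

section Bernoulli

variable {p : ℕ} [Fact p.Prime]

theorem norm_half_le_one (hp : 2 < p) : ‖(1 / 2 : ℚ_[p])‖ ≤ 1 := by
  have := norm_natCast_eq_one_of_lt (p := p) (k := 2) (by norm_num) hp
  push_cast at this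
  rw [norm_div, this]
  simp

theorem norm_bernoulli_le_one (hp : 2 < p) {n : ℕ} (hn : ¬ (p - 1) ∣ n) :
    ‖((bernoulli n : ℚ) : ℚ_[p])‖ ≤ 1 := by
  rcases Nat.even_or_odd' n with ⟨k, rfl | rfl⟩
  · obtain ⟨z, hz⟩ := Bernoulli.vonStaudt_clausen k
    rw [← sub_eq_iff_eq_add.mpr hz]
    change _ ∈ PadicInt.subring p
    push_cast
    refine Subring.sub_mem _ (intCast_mem _ z) (Subring.sum_mem _ fun q hq => ?_)
    rw [mem_filter] at hq
    have hqp : p.Coprime q := (Nat.coprime_primes Fact.out hq.2.1).mpr (by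
      rintro rfl
      exact hn hq.2.2)
    change ‖_‖ ≤ 1
    rw [norm_div, (Padic.norm_natCast_eq_one_iff).mpr hqp]
    simp
  · rcases Nat.eq_zero_or_pos k with rfl | hk
    · rw [mul_zero, zero_add, bernoulli_one]
      push_cast
      rw [neg_div, norm_neg]
      exact norm_half_le_one hp
    · rw [bernoulli_eq_zero_of_odd ⟨k, rfl⟩ (by omega)]
      simp

theorem norm_mul_bernoulli_le_one (hp : 2 < p) (n : ℕ) :
    ‖(p : ℚ_[p]) * ((bernoulli n : ℚ) : ℚ_[p])‖ ≤ 1 := by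
  by_cases hn : (p - 1) ∣ n
  · have hn2 : Even n := by
      refine (even_iff_two_dvd.mpr ?_)
      have : Even (p - 1) := Nat.Prime.even_sub_one Fact.out (by omega)
      exact (even_iff_two_dvd.mp this).trans hn
    obtain ⟨k, rfl⟩ := even_iff_exists_two_mul.mp hn2
    obtain ⟨z, hz⟩ := Bernoulli.vonStaudt_clausen k
    rw [← sub_eq_iff_eq_add.mpr hz]
    change _ ∈ PadicInt.subring p
    push_cast
    rw [mul_sub, mul_sum]
    refine Subring.sub_mem _ (mul_mem (natCast_mem _ p) (intCast_mem _ z))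
      (Subring.sum_mem _ fun q hq => ?_)
    rw [mem_filter] at hq
    change ‖_‖ ≤ 1
    by_cases hqp : p = q
    · subst hqp
      rw [mul_one_div_cancel (by exact_mod_cast (Fact.out : p.Prime).ne_zero), norm_one]
    · rw [norm_mul, norm_div, (Padic.norm_natCast_eq_one_iff).mpr
        ((Nat.coprime_primes Fact.out hq.2.1).mpr hqp)]
      simpa using Padic.norm_int_le_one (p := p) p
  · rw [norm_mul]
    exact mul_le_one₀ (by simpa using Padic.norm_int_le_one (p := p) p) (norm_nonneg _)
      (norm_bernoulli_le_one hp hn)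

variable (p)

theorem bernoulliValue_eq_sum (n : ℕ) (x : ℚ_[p]) :
    bernoulliValue p n x = ∑ k ∈ range (n + 1),
      ((bernoulli k : ℚ) : ℚ_[p]) * (n.choose k : ℚ_[p]) * x ^ (n - k) := by
  simp only [bernoulliValue, Polynomial.bernoulli_def, map_sum, Polynomial.aeval_monomial]
  rw [← sum_range_reflect]
  refine sum_congr rfl fun k hk => ?_
  rw [mem_range] at hk
  rw [Nat.add_sub_cancel, Nat.sub_sub_self (by omega), Nat.choose_symm (by omega)]
  simp

theorem bernoulliValue_one_add (n : ℕ) (x : ℚ_[p]) :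
    bernoulliValue p n (1 + x) = bernoulliValue p n x + n * x ^ (n - 1) := by
  have := congrArg (Polynomial.aeval x) (Polynomial.bernoulli_comp_one_add_X n)
  simpa [bernoulliValue, Polynomial.aeval_comp] using this

theorem bernoulliValue_one_sub (n : ℕ) (x : ℚ_[p]) :
    bernoulliValue p n (1 - x) = (-1) ^ n * bernoulliValue p n x := by
  have := congrArg (Polynomial.aeval x) (Polynomial.bernoulli_comp_one_sub_X n)
  simpa [bernoulliValue, Polynomial.aeval_comp] using this

theorem bernoulliValue_zero (n : ℕ) :
    bernoulliValue p n 0 = ((bernoulli n : ℚ) : ℚ_[p]) := by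
  rw [bernoulliValue_eq_sum, sum_range_succ, sum_eq_zero]
  · simp
  · intro k hk
    rw [mem_range] at hk
    simp [zero_pow (Nat.sub_ne_zero_of_lt hk)]

variable {p}

theorem padicCongr_bernoulliValue (hp : 2 < p) {n : ℕ} (hn : n < p - 1) {x y : ℚ_[p]}
    (hx : ‖x‖ ≤ 1) (h : PadicCongr p 1 x y) :
    PadicCongr p 1 (bernoulliValue p n x) (bernoulliValue p n y) := by
  rw [bernoulliValue_eq_sum, bernoulliValue_eq_sum]
  refine PadicCongr.sum fun k hk => (h.pow hx _).mul_left ?_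
  rw [mem_range] at hk
  rw [norm_mul]
  refine mul_le_one₀ ?_ (norm_nonneg _) (by simpa using Padic.norm_int_le_one (p := p) (n.choose k))
  rcases Nat.eq_zero_or_pos k with rfl | hk0
  · simp
  · exact norm_bernoulli_le_one hp fun hd => absurd (Nat.le_of_dvd hk0 hd) (by omega)

/-- In the expansion in powers of x, the linear term has an odd-index Bernoulli number, hence
vanishes; the quadratic one has a p-integral coefficient; from the cubic on, the third factor p
absorbs the denominator of B_k. -/
theorem padicCongr_bernoulliValue_sub (hp : 2 < p) {n : ℕ} (hn : Even n) (hn4 : 4 ≤ n)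
    (hn2 : ¬ (p - 1) ∣ (n - 2)) {x : ℚ_[p]} (hx : PadicCongr p 1 x 0) :
    PadicCongr p 2 (bernoulliValue p n x - ((bernoulli n : ℚ) : ℚ_[p])) 0 := by
  obtain ⟨t, ht⟩ := hx
  rw [sub_zero, pow_one] at ht
  have hsq : PadicCongr p 2 ((p : ℚ_[p]) ^ 2) 0 := ⟨1, by simp⟩
  have ht1 : ‖(t : ℚ_[p])‖ ≤ 1 := t.2
  have hint : ∀ c : ℕ, ‖(c : ℚ_[p])‖ ≤ 1 := fun c => by
    simpa using Padic.norm_int_le_one (p := p) c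
  have key : ∀ z : ℚ_[p], ‖z‖ ≤ 1 → PadicCongr p 2 (z * (p : ℚ_[p]) ^ 2) 0 := fun z hz => by
    simpa using hsq.mul_left hz
  rw [bernoulliValue_eq_sum, sum_range_succ, Nat.choose_self, Nat.sub_self, pow_zero, Nat.cast_one,
    mul_one, mul_one, add_sub_cancel_right]
  have : (0 : ℚ_[p]) = ∑ k ∈ range n, (0 : ℚ_[p]) := by simp
  rw [this]
  refine PadicCongr.sum fun k hk => ?_
  rw [mem_range] at hk
  by_cases h1 : k = n - 1
  · subst h1
    rw [bernoulli_eq_zero_of_odd (Nat.Even.sub_odd (by omega) hn odd_one) (by omega)]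
    simpa using PadicCongr.refl 0
  by_cases h2 : k = n - 2
  · rw [h2, show n - (n - 2) = 2 by omega, ht]
    have := key (((bernoulli (n - 2) : ℚ) : ℚ_[p]) * (n.choose (n - 2) : ℚ_[p]) * (t : ℚ_[p]) ^ 2)
      (by
        rw [norm_mul, norm_mul, norm_pow]
        exact mul_le_one₀ (mul_le_one₀ (norm_bernoulli_le_one hp hn2) (norm_nonneg _) (hint _))
          (by positivity) (pow_le_one₀ (norm_nonneg _) ht1))
    convert this using 1
    ring
  · obtain ⟨d, hd⟩ : ∃ d, n - k = d + 3 := ⟨n - k - 3, by omega⟩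
    rw [hd, ht]
    have := key (((p : ℚ_[p]) * ((bernoulli k : ℚ) : ℚ_[p])) * (n.choose k : ℚ_[p]) *
      ((p : ℚ_[p]) ^ d * (t : ℚ_[p]) ^ (d + 3))) (by
        rw [norm_mul, norm_mul ((p : ℚ_[p]) * _), norm_mul ((p : ℚ_[p]) ^ d), norm_pow, norm_pow]
        exact mul_le_one₀ (mul_le_one₀ (norm_mul_bernoulli_le_one hp k) (norm_nonneg _) (hint _))
          (by positivity) (mul_le_one₀ (pow_le_one₀ (norm_nonneg _) (hint p)) (by positivity)
            (pow_le_one₀ (norm_nonneg _) ht1)))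
    convert this using 1
    ring

theorem bernoulli_div_step {n : ℕ} (hn : Even n) (hn0 : n ≠ 0) (x b : ℚ_[p]) :
    (bernoulliValue p n (-(x + 1)) - b) / n - (bernoulliValue p n (-x) - b) / n
      = (x + 1) ^ (n - 1) := by
  have h := bernoulliValue_one_add p n (-(x + 1))
  rw [show 1 + -(x + 1) = -x by ring,
    (Nat.Even.sub_odd (Nat.one_le_iff_ne_zero.mpr hn0) hn odd_one).neg_pow] at h
  have : (n : ℚ_[p]) ≠ 0 := by exact_mod_cast hn0
  rw [h]
  field_simp
  ring

theorem padicCongr_sq_mul_bernoulliValue_step (hp : 3 < p) {x : ℚ_[p]} (hx : ‖x + 1‖ = 1) :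
    PadicCongr p 1 ((x + 1) ^ 2 * (bernoulliValue p (p - 2) (-(x + 1)) -
      bernoulliValue p (p - 2) (-x))) 2 := by
  have h := bernoulliValue_one_add p (p - 2) (-(x + 1))
  have hpe : Even (p - 2 - 1) := by
    have : Even (p - 1) := Nat.Prime.even_sub_one Fact.out (by omega)
    obtain ⟨q, hq⟩ := this
    exact ⟨q - 1, by omega⟩
  rw [show 1 + -(x + 1) = -x by ring, hpe.neg_pow] at h
  have e : (x + 1) ^ 2 * (bernoulliValue p (p - 2) (-(x + 1)) - bernoulliValue p (p - 2) (-x))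
      = (2 - (p : ℚ_[p])) * (x + 1) ^ (p - 1) := by
    rw [h, show p - 1 = 2 + (p - 2 - 1) by omega, pow_add, Nat.cast_sub (by omega)]
    push_cast
    ring
  rw [e]
  have h2 : PadicCongr p 1 (2 - (p : ℚ_[p])) 2 := by
    simpa using (PadicCongr.refl 2).sub PadicCongr.natCast_self
  have h2n : ‖(2 : ℚ_[p])‖ ≤ 1 := by simpa using Padic.norm_int_le_one (p := p) 2
  simpa using h2.mul (h2.norm_le_one h2n) (by simp) (PadicCongr.pow_card_sub_one hx)

theorem bernoulliValue_zero_of_sub_two (hp : 3 < p) : bernoulliValue p (p - 2) 0 = 0 := by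
  have : Even (p - 1) := Nat.Prime.even_sub_one Fact.out (by omega)
  rw [bernoulliValue_zero, bernoulli_eq_zero_of_odd _ (by omega), Rat.cast_zero]
  rw [show p - 2 = p - 1 - 1 by omega]
  exact Nat.Even.sub_odd (by omega) this odd_one

/-- Modulo p, -m is fixed by y ↦ 1 - y, under which B_{p-2} changes sign because p - 2 is odd. -/
theorem padicCongr_bernoulliValue_half (hp : 3 < p) {m : ℕ} (hm : p = 2 * m + 1) {x : ℚ_[p]}
    (hx : PadicCongr p 1 x m) : PadicCongr p 1 (bernoulliValue p (p - 2) (-x)) 0 := by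
  have hm1 : ‖(m : ℚ_[p])‖ ≤ 1 := by simpa using Padic.norm_int_le_one (p := p) m
  refine (padicCongr_bernoulliValue (by omega) (by omega)
    (by rw [norm_neg]; exact hx.norm_le_one hm1) hx.neg).trans ?_
  have h := bernoulliValue_one_sub p (p - 2) (-(m : ℚ_[p]))
  have hodd : Odd (p - 2) := ⟨m - 1, by omega⟩
  rw [hodd.neg_one_pow] at h
  have h1 : PadicCongr p 1 (1 - -(m : ℚ_[p])) (-(m : ℚ_[p])) := by
    refine ⟨1, ?_⟩
    have : (p : ℚ_[p]) = 2 * m + 1 := by exact_mod_cast congrArg (Nat.cast : ℕ → ℚ_[p]) hm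
    rw [pow_one, PadicInt.coe_one]
    linear_combination -this
  have h2 := padicCongr_bernoulliValue (n := p - 2) (by omega) (by omega)
    (h1.norm_le_one (by simpa using hm1)) h1
  rw [h] at h2
  refine PadicCongr.of_mul_left (z := 2)
    (by simpa using norm_natCast_eq_one_of_lt (p := p) (k := 2) (by omega) (by omega)) ?_
  have h3 := (PadicCongr.refl (bernoulliValue p (p - 2) (-(m : ℚ_[p])))).sub h2
  convert h3 using 1 <;> ring

/-- Both sides start at 0 and have increments 2/(i+1)². Thus zeros of B_{p-2} modulo p give
vanishing sums of inverse squares. -/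
theorem padicCongr_two_mul_sum_inv_sq (hp : 3 < p) {j : ℕ} (hj : j < p) :
    PadicCongr p 1 (bernoulliValue p (p - 2) (-(j : ℚ_[p])))
      (2 * ∑ k ∈ Icc 1 j, 1 / (k : ℚ_[p]) ^ 2) := by
  refine PadicCongr.of_step (F := fun j : ℕ => bernoulliValue p (p - 2) (-(j : ℚ_[p])))
    (G := fun j => 2 * ∑ k ∈ Icc 1 j, 1 / (k : ℚ_[p]) ^ 2) (Nat.zero_le j) ?_ ?_
  · simpa [bernoulliValue_zero_of_sub_two hp] using PadicCongr.refl 0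
  · intro i _ hi
    have hu : ‖(i : ℚ_[p]) + 1‖ = 1 := by
      exact_mod_cast norm_natCast_eq_one_of_lt (p := p) (k := i + 1) (by omega) (by omega)
    have hi0 : (i : ℚ_[p]) + 1 ≠ 0 := by exact_mod_cast i.succ_ne_zero
    refine PadicCongr.of_mul_left (z := ((i : ℚ_[p]) + 1) ^ 2) (by rw [norm_pow, hu, one_pow]) ?_
    simp only [sum_Icc_succ_top (Nat.le_add_left 1 i), mul_add, add_sub_cancel_left]
    push_cast
    refine ((padicCongr_sq_mul_bernoulliValue_step hp hu).trans (PadicCongr.of_eq ?_))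
    field_simp

theorem padicCongr_sum_inv_sq_of_bernoulliValue (hp : 3 < p) {j : ℕ} (hj : j < p)
    (h : PadicCongr p 1 (bernoulliValue p (p - 2) (-(j : ℚ_[p]))) 0) :
    PadicCongr p 1 (∑ k ∈ Icc 1 j, 1 / (k : ℚ_[p]) ^ 2) 0 := by
  refine PadicCongr.of_mul_left (z := 2)
    (by simpa using norm_natCast_eq_one_of_lt (p := p) (k := 2) (by omega) (by omega)) ?_
  simpa using (padicCongr_two_mul_sum_inv_sq hp hj).symm.trans h

theorem padicCongr_sum_inv_sq_half (hp : 3 < p) {m : ℕ} (hm : p = 2 * m + 1) :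
    PadicCongr p 1 (∑ k ∈ Icc 1 m, 1 / (k : ℚ_[p]) ^ 2) 0 :=
  padicCongr_sum_inv_sq_of_bernoulliValue hp (by omega)
    (padicCongr_bernoulliValue_half hp hm (PadicCongr.refl _))

theorem padicCongr_sum_inv_sq (hp : 3 < p) :
    PadicCongr p 1 (∑ k ∈ Icc 1 (p - 1), 1 / (k : ℚ_[p]) ^ 2) 0 := by
  refine padicCongr_sum_inv_sq_of_bernoulliValue hp (by omega) ?_
  have h1 : PadicCongr p 1 (-((p - 1 : ℕ) : ℚ_[p])) (1 - 0) := by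
    refine ⟨-1, ?_⟩
    rw [Nat.cast_sub (by omega)]
    push_cast
    ring
  refine (padicCongr_bernoulliValue (by omega) (by omega) (h1.norm_le_one (by simp)) h1).trans ?_
  rw [bernoulliValue_one_sub, bernoulliValue_zero_of_sub_two hp, mul_zero]
  exact PadicCongr.refl 0

end Bernoulli

/-! ### Starting values of the sums at multiples of p -/

section Base

variable {p : ℕ} [Fact p.Prime]

theorem padicCongr_padicChoose_of_neg_one {x : ℤ_[p]} (hx : PadicCongr p 1 (x : ℚ_[p]) (-1))
    {k : ℕ} (hk : k < p) : PadicCongr p 1 (padicChoose p x k) ((-1) ^ k) := by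
  induction k with
  | zero => simpa [padicChoose_zero] using PadicCongr.refl 1
  | succ k ih =>
    have hk1 : ‖(k : ℚ_[p]) + 1‖ = 1 := by
      exact_mod_cast norm_natCast_eq_one_of_lt (p := p) (k := k + 1) (by omega) hk
    refine PadicCongr.of_mul_left hk1 ?_
    rw [succ_mul_padicChoose_succ]
    have h1 : PadicCongr p 1 ((x : ℚ_[p]) - k) (-1 - k) := hx.sub (PadicCongr.refl _)
    have h2 : ‖(-1 - k : ℚ_[p])‖ ≤ 1 := by
      rw [← norm_neg, neg_sub, sub_neg_eq_add, hk1]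
    refine (h1.mul (h1.norm_le_one h2) (by simp) (ih (by omega))).trans (PadicCongr.of_eq ?_)
    ring

/-- Absorption extracts x/k, and the remaining binom(x-1, k-1) is needed only modulo p. -/
theorem padicCongr_padicChoose_of_zero {x : ℤ_[p]} (hx : PadicCongr p 1 (x : ℚ_[p]) 0)
    {k : ℕ} (hk0 : 0 < k) (hk : k < p) :
    PadicCongr p 2 (padicChoose p x k) ((x : ℚ_[p]) * ((-1) ^ (k - 1) / k)) := by
  obtain ⟨k, rfl⟩ : ∃ l, k = l + 1 := ⟨k - 1, by omega⟩
  have hk1 : ‖((k + 1 : ℕ) : ℚ_[p])‖ = 1 := norm_natCast_eq_one_of_lt hk0 hk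
  refine PadicCongr.of_mul_left hk1 ?_
  have h := succ_mul_padicChoose_add_one_succ p (x - 1) k
  have hk2 : (k : ℚ_[p]) + 1 ≠ 0 := by exact_mod_cast k.succ_ne_zero
  push_cast at h ⊢
  rw [sub_add_cancel, sub_add_cancel] at h
  rw [h]
  have hx' : PadicCongr p 1 ((x - 1 : ℤ_[p]) : ℚ_[p]) (-1) := by
    simpa using hx.sub (PadicCongr.refl 1)
  refine (PadicCongr.mul_congr_sq hx
    (padicCongr_padicChoose_of_neg_one hx' (k := k) (by omega))).trans (PadicCongr.of_eq ?_)
  field_simp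

theorem norm_inv_natCast_le_one {k : ℕ} (hk0 : 0 < k) (hk : k < p) : ‖(1 / k : ℚ_[p])‖ ≤ 1 := by
  rw [norm_div, norm_natCast_eq_one_of_lt hk0 hk]
  simp

theorem padicCongr_altChooseSum_of_zero (hp : 3 < p) {x : ℤ_[p]}
    (hx : PadicCongr p 1 (x : ℚ_[p]) 0) : PadicCongr p 2 (altChooseSum p x (p - 1)) 0 := by
  have h := PadicCongr.mul_congr_sq hx (padicCongr_sum_inv_sq hp)
  rw [mul_zero, mul_sum] at h
  refine PadicCongr.trans (PadicCongr.sum fun k hk => ?_) h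
  rw [mem_Icc] at hk
  have hk' : k < p := by omega
  have h1 := (padicCongr_padicChoose_of_zero hx hk.1 hk').mul_left
    (z := (-1 : ℚ_[p]) ^ (k - 1) / (k : ℚ_[p]))
    (by rw [norm_div, norm_natCast_eq_one_of_lt hk.1 hk']; simp)
  refine h1.trans (PadicCongr.of_eq ?_)
  have hs : ((-1 : ℚ_[p]) ^ (k - 1)) ^ 2 = 1 := by rw [← pow_mul, mul_comm, pow_mul]; simp
  have hk0 : (k : ℚ_[p]) ≠ 0 := by exact_mod_cast (show k ≠ 0 by omega)
  field_simp
  rw [hs, one_mul]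

theorem padicCongr_chooseMulSum_of_zero (hp : 3 < p) {m : ℕ} (hm : p = 2 * m + 1) {x : ℤ_[p]}
    (hx : PadicCongr p 1 (x : ℚ_[p]) 0) : PadicCongr p 2 (chooseMulSum p x m) 0 := by
  have h := (PadicCongr.mul_congr_sq hx (padicCongr_sum_inv_sq_half hp hm)).neg
  rw [mul_zero, neg_zero, mul_sum, ← sum_neg_distrib] at h
  refine PadicCongr.trans (PadicCongr.sum fun k hk => ?_) h
  rw [mem_Icc] at hk
  have hk' : k < p := by omega
  have hx' : PadicCongr p 1 ((-1 - x : ℤ_[p]) : ℚ_[p]) (-1) := by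
    simpa using (PadicCongr.refl (-1)).sub hx
  have hi := norm_inv_natCast_le_one (p := p) hk.1 hk'
  have h1 := (padicCongr_padicChoose_of_zero hx hk.1 hk').mul_right
    (z := padicChoose p (-1 - x) k * (1 / (k : ℚ_[p])))
    (by rw [norm_mul]; exact mul_le_one₀ (norm_padicChoose_le_one _ _ _) (norm_nonneg _) hi)
  have h2 := PadicCongr.mul_congr_sq hx ((padicCongr_padicChoose_of_neg_one hx' hk').mul_left
    (z := (-1 : ℚ_[p]) ^ (k - 1) / (k : ℚ_[p]) * (1 / (k : ℚ_[p])))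
    (by
      rw [norm_mul, norm_div, norm_natCast_eq_one_of_lt hk.1 hk']
      simpa using hi))
  have hk0 : (k : ℚ_[p]) ≠ 0 := by exact_mod_cast (show k ≠ 0 by omega)
  refine PadicCongr.trans (PadicCongr.of_eq (by ring))
    (h1.trans (PadicCongr.trans (PadicCongr.of_eq (by ring)) (h2.trans (PadicCongr.of_eq ?_))))
  obtain ⟨l, rfl⟩ : ∃ l, k = l + 1 := ⟨k - 1, by omega⟩
  have hs : ((-1 : ℚ_[p]) ^ l) ^ 2 = 1 := by rw [← pow_mul, mul_comm, pow_mul]; simp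
  rw [Nat.add_sub_cancel, pow_succ]
  field_simp
  linear_combination -(x : ℚ_[p]) * hs

end Base

/-! ### Increments along a residue chain and the resulting congruences -/

section Main

variable {p : ℕ} [Fact p.Prime]

/-- The combination `-(B_{2p-2}(-a) - B_{2p-2}) / (2p-2) + 2 (B_{p-1}(-a) - B_{p-1}) / (p-1)`. -/
noncomputable def bernoulliCombination (p : ℕ) [Fact p.Prime] (x : ℚ_[p]) : ℚ_[p] :=
  -((bernoulliValue p (2 * p - 2) (-x) - ((bernoulli (2 * p - 2) : ℚ) : ℚ_[p]))
      / (2 * (p : ℚ_[p]) - 2))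
    + 2 * ((bernoulliValue p (p - 1) (-x) - ((bernoulli (p - 1) : ℚ) : ℚ_[p])) / ((p : ℚ_[p]) - 1))

theorem padicCongr_bernoulliCombination_of_zero (hp : 3 < p) {x : ℚ_[p]}
    (hx : PadicCongr p 1 x 0) : PadicCongr p 2 (bernoulliCombination p x) 0 := by
  have he : Even (p - 1) := Nat.Prime.even_sub_one Fact.out (by omega)
  obtain ⟨m, hm⟩ := he
  have hx' : PadicCongr p 1 (-x) 0 := by simpa using hx.neg
  have hn1 : ‖(p : ℚ_[p]) - 1‖ = 1 := by
    have := norm_natCast_eq_one_of_lt (p := p) (k := p - 1) (by omega) (by omega)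
    rwa [Nat.cast_sub (by omega), Nat.cast_one] at this
  have h2 : ‖(2 : ℚ_[p])‖ = 1 := by
    simpa using norm_natCast_eq_one_of_lt (p := p) (k := 2) (by omega) (by omega)
  have hn2 : ‖2 * (p : ℚ_[p]) - 2‖ = 1 := by
    rw [← mul_sub_one, norm_mul, hn1, h2, one_mul]
  have hA := padicCongr_bernoulliValue_sub (p := p) (n := p - 1) (by omega) ⟨m, hm⟩ (by omega)
    (fun h => absurd (Nat.le_of_dvd (by omega) h) (by omega)) hx'
  have hB := padicCongr_bernoulliValue_sub (p := p) (n := 2 * p - 2) (by omega) ⟨p - 1, by omega⟩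
    (by omega) (fun h => by
      rw [show 2 * p - 2 - 2 = (p - 1) + (p - 3) by omega] at h
      exact absurd (Nat.le_of_dvd (by omega) ((Nat.dvd_add_right dvd_rfl).1 h)) (by omega)) hx'
  have hA' := hA.mul_left (z := 2 / ((p : ℚ_[p]) - 1)) (by rw [norm_div, hn1, h2]; simp)
  have hB' := hB.mul_left (z := -1 / (2 * (p : ℚ_[p]) - 2)) (by rw [norm_div, hn2]; simp)
  rw [mul_zero] at hA' hB'
  have := hB'.add hA'
  rw [add_zero] at this
  refine PadicCongr.trans (PadicCongr.of_eq ?_) this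
  rw [bernoulliCombination]
  ring

/-- With (x+1)^(p-1) = 1 + w and p ∣ w, the weights give 2(1+w) - (1+w)² = 1 - w², so the Fermat
quotient cancels modulo p². -/
theorem padicCongr_bernoulliCombination_step (hp : 3 < p) {x : ℚ_[p]} (hx : ‖x + 1‖ = 1) :
    PadicCongr p 2 ((x + 1) ^ 2 * (bernoulliCombination p (x + 1) - bernoulliCombination p x))
      (x + 1) := by
  have he : Even (p - 1) := Nat.Prime.even_sub_one Fact.out (by omega)
  have h1 := bernoulli_div_step (p := p) (n := p - 1) he (by omega) x
    ((bernoulli (p - 1) : ℚ) : ℚ_[p])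
  have h2 := bernoulli_div_step (p := p) (n := 2 * p - 2) ⟨p - 1, by omega⟩ (by omega) x
    ((bernoulli (2 * p - 2) : ℚ) : ℚ_[p])
  rw [Nat.cast_sub (by omega), Nat.cast_one] at h1
  rw [Nat.cast_sub (by omega), Nat.cast_mul, Nat.cast_ofNat] at h2
  have e : (x + 1) ^ 2 * (bernoulliCombination p (x + 1) - bernoulliCombination p x)
      = (x + 1) * (2 * (x + 1) ^ (p - 1) - (x + 1) ^ (p - 1) * (x + 1) ^ (p - 1)) := by
    obtain ⟨q, hq⟩ : ∃ q, p - 1 = q + 1 := ⟨p - 2, by omega⟩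
    rw [show 2 * p - 2 - 1 = q + q + 1 by omega] at h2
    rw [show p - 1 - 1 = q by omega] at h1
    rw [hq]
    simp only [bernoulliCombination]
    rw [pow_succ (x + 1) q]
    rw [pow_succ, pow_add] at h2
    linear_combination (x + 1) ^ 2 * (2 * h1 - h2)
  rw [e]
  have hw : PadicCongr p 1 ((x + 1) ^ (p - 1) - 1) 0 := by
    simpa using (PadicCongr.pow_card_sub_one hx).sub (PadicCongr.refl 1)
  have hw2 := (PadicCongr.mul_congr_sq hw hw).mul_left (z := x + 1) hx.le
  have := (PadicCongr.refl (x + 1)).sub hw2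
  rw [mul_zero, mul_zero, sub_zero] at this
  refine PadicCongr.trans (PadicCongr.of_eq ?_) this
  ring

variable {x : ℤ_[p]} {j m : ℕ}

theorem norm_add_one_eq_one (hj : j + 1 < p) (hx : PadicInt.toZMod x = (j : ZMod p)) :
    ‖(x : ℚ_[p]) + 1‖ = 1 := by
  have h : PadicCongr p 1 (x : ℚ_[p]) ((j : ℤ_[p]) : ℚ_[p]) := by
    rw [PadicCongr.coe_iff_toZMod_eq, hx, map_natCast]
  refine (h.add (PadicCongr.refl 1)).norm_eq_one ?_
  exact_mod_cast norm_natCast_eq_one_of_lt (p := p) (k := j + 1) (by omega) hj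

theorem padicCongr_altChooseSum_step (hp : 3 < p) (hj : j + 1 < p)
    (hx : PadicInt.toZMod x = (j : ZMod p)) :
    PadicCongr p 2 (((x : ℚ_[p]) + 1) ^ 2 *
      (altChooseSum p (x + 1) (p - 1) - altChooseSum p x (p - 1)))
      ((x : ℚ_[p]) + 1 - (x - j)) := by
  have h := altChooseSum_add_one_sub p x (p - 1)
  have he : Even (p - 1) := Nat.Prime.even_sub_one Fact.out (by omega)
  rw [he.neg_one_pow, one_mul] at h
  rw [pow_two, mul_assoc, h, mul_sub, mul_one]
  exact (PadicCongr.refl _).sub (padicCongr_add_one_mul_padicChoose hj hx)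

theorem padicCongr_chooseMulSum_step (hm : p = 2 * m + 1) (hj : j + 1 < p)
    (hx : PadicInt.toZMod x = (j : ZMod p)) :
    PadicCongr p 2 (((x : ℚ_[p]) + 1) ^ 2 * (chooseMulSum p (x + 1) m - chooseMulSum p x m))
      (2 * ((x - j + if j < m then 0 else (p : ℚ_[p])) - (x + 1))) := by
  have h := ((padicCongr_add_one_mul_padicChoose_mul hm hj hx).sub
    (PadicCongr.refl ((x : ℚ_[p]) + 1))).mul_left (z := 2)
    (by simpa using Padic.norm_int_le_one (p := p) 2)
  rw [pow_two, mul_assoc, chooseMulSum_add_one_sub]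
  convert h using 1
  ring

theorem padicCongr_sum_step (hp : 3 < p) (hm : p = 2 * m + 1) (hj : j + 1 < p)
    (hx : PadicInt.toZMod x = (j : ZMod p)) :
    PadicCongr p 2 (((x : ℚ_[p]) + 1) ^ 2 *
      ((chooseMulSum p (x + 1) m + 2 * altChooseSum p (x + 1) (p - 1)) -
        (chooseMulSum p x m + 2 * altChooseSum p x (p - 1))))
      (if j < m then 0 else 2 * (p : ℚ_[p])) := by
  have h := (padicCongr_chooseMulSum_step hm hj hx).add ((padicCongr_altChooseSum_step hp hj
    hx).mul_left (z := 2) (by simpa using Padic.norm_int_le_one (p := p) 2))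
  convert h using 1
  · ring
  · split_ifs <;> ring

variable {a : ℤ_[p]} {r : ℕ}

theorem toZMod_add_natCast (ha : (p : ℤ_[p]) ∣ a) (j : ℕ) :
    PadicInt.toZMod (a + (j : ℤ_[p])) = (j : ZMod p) := by
  obtain ⟨b, rfl⟩ := ha
  simp

theorem padicCongr_sum_of_le (hp : 3 < p) (hm : p = 2 * m + 1) (ha : (p : ℤ_[p]) ∣ a)
    (hr : r ≤ m) :
    PadicCongr p 2 (chooseMulSum p (a + (r : ℤ_[p])) m + 2 * altChooseSum p (a + (r : ℤ_[p])) (p - 1)) 0 := by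
  have ha0 : PadicCongr p 1 (a : ℚ_[p]) 0 := by
    rw [← PadicInt.coe_zero, PadicCongr.coe_iff]
    simpa using ha
  refine PadicCongr.of_step
    (F := fun j : ℕ => chooseMulSum p (a + (j : ℤ_[p])) m + 2 * altChooseSum p (a + (j : ℤ_[p])) (p - 1))
    (G := fun _ => 0) (Nat.zero_le r) ?_ fun j _ hj => ?_
  · have := (padicCongr_chooseMulSum_of_zero hp hm ha0).add
      ((padicCongr_altChooseSum_of_zero hp ha0).mul_left (z := 2)
        (by simpa using Padic.norm_int_le_one (p := p) 2))
    simpa using this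
  · have hx := toZMod_add_natCast ha j
    have hu := norm_add_one_eq_one (by omega) hx
    refine PadicCongr.of_mul_left (z := (((a + (j : ℤ_[p]) : ℤ_[p]) : ℚ_[p]) + 1) ^ 2)
      (by rw [norm_pow, hu, one_pow]) ?_
    have := padicCongr_sum_step hp hm (j := j) (by omega) hx
    rw [if_pos (by omega)] at this
    simpa [add_assoc] using this

theorem padicCongr_sum_of_lt (hp : 3 < p) (hm : p = 2 * m + 1) (ha : (p : ℤ_[p]) ∣ a)
    (hr : m ≤ r) (hrp : r < p) :
    PadicCongr p 2 (chooseMulSum p (a + (r : ℤ_[p])) m + 2 * altChooseSum p (a + (r : ℤ_[p])) (p - 1))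
      ((p : ℚ_[p]) * bernoulliValue p (p - 2) (-((a + (r : ℤ_[p]) : ℤ_[p]) : ℚ_[p]))) := by
  have ha0 : PadicCongr p 1 (a : ℚ_[p]) 0 := by
    rw [← PadicInt.coe_zero, PadicCongr.coe_iff]
    simpa using ha
  refine PadicCongr.of_step
    (F := fun j : ℕ => chooseMulSum p (a + (j : ℤ_[p])) m + 2 * altChooseSum p (a + (j : ℤ_[p])) (p - 1))
    (G := fun j : ℕ => (p : ℚ_[p]) * bernoulliValue p (p - 2) (-((a + (j : ℤ_[p]) : ℤ_[p]) : ℚ_[p]))) hr ?_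
    fun j hmj hj => ?_
  · have h1 : PadicCongr p 1 ((a + (m : ℤ_[p]) : ℤ_[p]) : ℚ_[p]) m := by
      simpa using ha0.add (PadicCongr.refl (m : ℚ_[p]))
    have h2 := PadicCongr.mul_congr_sq PadicCongr.natCast_self
      (padicCongr_bernoulliValue_half hp hm h1)
    rw [mul_zero] at h2
    -- At j = m both sides are 0 modulo p², so the two regimes meet here.
    exact (padicCongr_sum_of_le hp hm ha le_rfl).trans h2.symm
  · have hx := toZMod_add_natCast ha j
    have hu := norm_add_one_eq_one (by omega) hx
    refine PadicCongr.of_mul_left (z := (((a + (j : ℤ_[p]) : ℤ_[p]) : ℚ_[p]) + 1) ^ 2)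
      (by rw [norm_pow, hu, one_pow]) ?_
    have h1 := padicCongr_sum_step hp hm (j := j) (by omega) hx
    rw [if_neg (by omega)] at h1
    have h2 := PadicCongr.mul_congr_sq PadicCongr.natCast_self
      (padicCongr_sq_mul_bernoulliValue_step hp hu)
    rw [mul_comm (2 : ℚ_[p]) (p : ℚ_[p])] at h1
    have h3 := h1.trans h2.symm
    convert h3 using 1
    · push_cast
      simp only [add_assoc]
    · push_cast
      simp only [add_assoc]
      ring

/-- Here `a` is the multiple of p that stays constant along the chain. The term with a/2 supplies
the part -a/(x+1)² of each increment. -/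
theorem padicCongr_altChooseSum (hp : 3 < p) (ha : (p : ℤ_[p]) ∣ a) (hrp : r < p) :
    PadicCongr p 2 (altChooseSum p (a + (r : ℤ_[p])) (p - 1))
      (bernoulliCombination p ((a + (r : ℤ_[p]) : ℤ_[p]) : ℚ_[p]) -
        (a : ℚ_[p]) / 2 * bernoulliValue p (p - 2) (-((a + (r : ℤ_[p]) : ℤ_[p]) : ℚ_[p]))) := by
  have ha0 : PadicCongr p 1 (a : ℚ_[p]) 0 := by
    rw [← PadicInt.coe_zero, PadicCongr.coe_iff]
    simpa using ha
  have ha2 : PadicCongr p 1 ((a : ℚ_[p]) / 2) 0 := by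
    have := ha0.mul_right (norm_half_le_one (p := p) (by omega))
    simpa [div_eq_mul_inv] using this
  refine PadicCongr.of_step (F := fun j : ℕ => altChooseSum p (a + (j : ℤ_[p])) (p - 1))
    (G := fun j : ℕ => bernoulliCombination p ((a + (j : ℤ_[p]) : ℤ_[p]) : ℚ_[p]) -
        (a : ℚ_[p]) / 2 * bernoulliValue p (p - 2) (-((a + (j : ℤ_[p]) : ℤ_[p]) : ℚ_[p]))) (Nat.zero_le r) ?_
    fun j _ hj => ?_
  · have h1 : PadicCongr p 1 (bernoulliValue p (p - 2) (-(a : ℚ_[p]))) 0 := by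
      have hn : PadicCongr p 1 (-(a : ℚ_[p])) 0 := by simpa using ha0.neg
      have := padicCongr_bernoulliValue (n := p - 2) (by omega) (by omega)
        (hn.norm_le_one (by simp)) hn
      rwa [bernoulliValue_zero_of_sub_two hp] at this
    have h2 := (padicCongr_bernoulliCombination_of_zero hp ha0).sub
      (PadicCongr.mul_congr_sq ha2 h1)
    rw [mul_zero, sub_zero] at h2
    simpa using (padicCongr_altChooseSum_of_zero hp ha0).trans h2.symm
  · have hx := toZMod_add_natCast ha j
    have hu := norm_add_one_eq_one (by omega) hx
    refine PadicCongr.of_mul_left (z := (((a + (j : ℤ_[p]) : ℤ_[p]) : ℚ_[p]) + 1) ^ 2)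
      (by rw [norm_pow, hu, one_pow]) ?_
    have h1 := padicCongr_altChooseSum_step hp (j := j) (by omega) hx
    have h2 := (padicCongr_bernoulliCombination_step hp hu).sub
      (PadicCongr.mul_congr_sq ha2 (padicCongr_sq_mul_bernoulliValue_step hp hu))
    have h3 := h1.trans (PadicCongr.trans (PadicCongr.of_eq (by push_cast; ring)) h2.symm)
    convert h3 using 1
    · push_cast
      simp only [add_assoc]
    · push_cast
      simp only [add_assoc]
      ring

end Main

theorem theorem2p1 (p : ℕ) [Fact p.Prime] (hp : 3 < p) (a : ℤ_[p])
    (ha : ¬ (p : ℤ_[p]) ∣ a) :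
    (a.zmodRepr ≤ (p - 1) / 2 →
      PadicCongr p 2
        ((∑ k ∈ Finset.Icc 1 ((p - 1) / 2),
            padicChoose p a k * padicChoose p (-1 - a) k / (k : ℚ_[p]))
          + 2 * ∑ k ∈ Finset.Icc 1 (p - 1),
            (-1 : ℚ_[p]) ^ (k - 1) / (k : ℚ_[p]) * padicChoose p a k)
        0) ∧
    ((p - 1) / 2 < a.zmodRepr →
      PadicCongr p 2
        ((∑ k ∈ Finset.Icc 1 ((p - 1) / 2),
            padicChoose p a k * padicChoose p (-1 - a) k / (k : ℚ_[p]))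
          + 2 * ∑ k ∈ Finset.Icc 1 (p - 1),
            (-1 : ℚ_[p]) ^ (k - 1) / (k : ℚ_[p]) * padicChoose p a k)
        ((p : ℚ_[p]) * bernoulliValue p (p - 2) (-(a : ℚ_[p])))) ∧
    PadicCongr p 2
      (∑ k ∈ Finset.Icc 1 (p - 1),
        (-1 : ℚ_[p]) ^ (k - 1) / (k : ℚ_[p]) * padicChoose p a k)
      (-((bernoulliValue p (2 * p - 2) (-(a : ℚ_[p])) - ((bernoulli (2 * p - 2) : ℚ) : ℚ_[p]))
            / (2 * (p : ℚ_[p]) - 2))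
        + 2 * ((bernoulliValue p (p - 1) (-(a : ℚ_[p])) - ((bernoulli (p - 1) : ℚ) : ℚ_[p]))
            / ((p : ℚ_[p]) - 1))
        - ((a : ℚ_[p]) - (a.zmodRepr : ℚ_[p])) / 2
            * bernoulliValue p (p - 2) (-(a : ℚ_[p]))) := by
  have hp2 : Even (p - 1) := Nat.Prime.even_sub_one Fact.out (by omega)
  obtain ⟨m, hm⟩ := hp2
  have hm1 : (p - 1) / 2 = m := by omega
  have hm2 : p = 2 * m + 1 := by omega
  have hd : (p : ℤ_[p]) ∣ a - (a.zmodRepr : ℤ_[p]) := by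
    have := PadicInt.sub_zmodRepr_mem a
    rwa [PadicInt.maximalIdeal_eq_span_p, Ideal.mem_span_singleton] at this
  have hr := PadicInt.zmodRepr_lt_p a
  -- The chain runs from the multiple of p below `a` up to `a` itself.
  have ea : a - (a.zmodRepr : ℤ_[p]) + (a.zmodRepr : ℤ_[p]) = a := sub_add_cancel _ _
  rw [hm1]
  refine ⟨fun h => ?_, fun h => ?_, ?_⟩
  · have := padicCongr_sum_of_le hp hm2 hd h
    rwa [ea] at this
  · have := padicCongr_sum_of_lt hp hm2 hd h.le hr
    rwa [ea] at this
  · have := padicCongr_altChooseSum hp hd hr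
    rw [ea] at this
    rw [PadicInt.coe_sub, PadicInt.coe_natCast] at this
    exact this
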